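/- Let $(X,\mu)$ be a probability space with a tree $\mathcal T$: a family of measurable subsets of $X$ of positive measure with $X\in\mathcal T$, such that every $I\in\mathcal T$ is the union of a finite family $\mathcal C(I)\subseteq\mathcal T$ of at least two subsets of $I$ with pairwise $\mu$-null intersections; $\mathcal T=\bigcup_{m\ge 0}\mathcal T_{(m)}$, where $\mathcal T_{(0)}=\{X\}$ and $\mathcal T_{(m+1)}=\bigcup_{I\in\mathcal T_{(m)}}\mathcal C(I)$; $\sup_{I\in\mathcal T_{(m)}}\mu(I)\to 0$ as $m\to\infty$; and $\mathcal T$ differentiates $L^1(X,\mu)$. Put $M_{\mathcal T}\phi(x)=\sup\{\mu(I)^{-1}\int_I|\phi|\,d\mu: x\in I\in\mathcal T\}$. Let $p>1$, $p'=p/(p-1)$, and let $\omega_p:[0,1]\to[1,\frac{p}{p-1}]$ be the inverse function of $H_p(z)=-(p-1)z^p+pz^{p-1}$ on $[1,\frac p{p-1}]$. Let $w$ be an $A_p$ weight with respect to $\mathcal T$, that is, a positive integrable function such that, with $\sigma=w^{-1/(p-1)}$, $w(I)=\int_I w\,d\mu$ and $\sigma(I)=\int_I\sigma\,d\mu$,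 $$[w]_p=\sup_{I\in\mathcal T}\frac{w(I)\,\sigma(I)^{p-1}}{\mu(I)^p}<\infty .$$ Then $\sigma$ is integrable, and for every integrable $\phi\ge 0$ with $\int_X\phi^p w\,d\mu=F<\infty$ and $\int_X\phi\,d\mu=f$, the integral $\int_X\phi^{p-1}w\,d\mu$ is finite and $$\int_X(M_{\mathcal T}\phi)^p w\,d\mu\le [w]_p^{p/(p-1)}\,F\,\omega_p\!\left(\frac{f^p}{\sigma(X)^{p-1}F}\right)^{p}\omega_{p'}\!\left(\frac{\left(\int_X\phi^{p-1}w\,d\mu\right)^{p'}}{w(X)^{p'-1}\,F\,\omega_p\!\left(\frac{f^p}{\sigma(X)^{p-1}F}\right)^{p}}\right)^{p'},$$ where the arguments of $\omega_p$ and $\omega_{p'}$ lie in $[0,1]$ (if $F=0$, then $\phi=0$ almost everywhere, a quotient $0/0$ is read as $0$, and both sides are $0$). In particular, the Bellman function $$\mathcal B^{\mathcal T}_{p,w}(F,f)=\sup\left\{\int_X(M_{\mathcal T}\phi)^p w\,d\mu:\ \phi\ge 0,\ \int_X\phi^p w\,d\mu=F,\ \int_X\phi\,d\mu=f\right\}$$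 satisfies $$\mathcal B^{\mathcal T}_{p,w}(F,f)\le p^{p'}\,[w]_p^{p/(p-1)}\,F\,\omega_p\!\left(\frac{f^p}{\sigma(X)^{p-1}F}\right)^{p}.$$ -/

import Mathlib

open MeasureTheory Set Filter Topology
open scoped ENNReal

noncomputable section

namespace TreeMaximal

variable {X : Type*} [MeasurableSpace X]

/-- The `m`-th generation `T_(m)`: `T_(0) = {X}` and `T_(m+1)` is the union of the children
`C I` of the sets `I` in `T_(m)`. -/
def generation (C : Set X → Set (Set X)) : ℕ → Set (Set X)
  | 0 => {univ}
  | m + 1 => ⋃ I ∈ generation C m, C I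

/-- `T` differentiates `L¹(μ)`: for every integrable `φ` and almost every `x`, the averages of `φ`
over the sets `I` of `T` that contain `x` tend to `φ x` as `μ I` tends to `0`. -/
def DifferentiatesL1 (μ : Measure X) (T : Set (Set X)) : Prop :=
  ∀ φ : X → ℝ, Integrable φ μ → ∀ᵐ x ∂μ, ∀ ε : ℝ, 0 < ε → ∃ δ : ℝ, 0 < δ ∧
    ∀ I ∈ T, x ∈ I → μ.real I < δ → |(⨍ y in I, φ y ∂μ) - φ x| < ε

/-- `T` is a tree on `(X, μ)` with children map `C`. -/
structure IsTreeWith (μ : Measure X) (T : Set (Set X)) (C : Set X → Set (Set X)) : Prop where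
  measurableSet : ∀ I ∈ T, MeasurableSet I
  univ_mem : univ ∈ T
  measure_pos : ∀ I ∈ T, 0 < μ I
  children_subset : ∀ I ∈ T, C I ⊆ T
  children_finite : ∀ I ∈ T, (C I).Finite
  children_nontrivial : ∀ I ∈ T, (C I).Nontrivial
  children_le : ∀ I ∈ T, ∀ J ∈ C I, J ⊆ I
  children_aedisjoint : ∀ I ∈ T, (C I).Pairwise (AEDisjoint μ)
  eq_sUnion_children : ∀ I ∈ T, I = ⋃₀ C I
  eq_iUnion_generation : T = ⋃ m, generation C m
  tendsto_measure : Tendsto (fun m => ⨆ I ∈ generation C m, μ I) atTop (𝓝 0)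
  differentiates : DifferentiatesL1 μ T

/-- `T` is a tree on `(X, μ)`. -/
def IsTree (μ : Measure X) (T : Set (Set X)) : Prop :=
  ∃ C : Set X → Set (Set X), IsTreeWith μ T C

/-- The maximal operator `M_T φ (x) = sup { μ(I)⁻¹ ∫_I |φ| dμ : x ∈ I ∈ T }`, with values
in `[0, ∞]`. -/
def maximalFunction (μ : Measure X) (T : Set (Set X)) (φ : X → ℝ) (x : X) : ℝ≥0∞ :=
  ⨆ I ∈ T, ⨆ _ : x ∈ I, (∫⁻ y in I, ‖φ y‖ₑ ∂μ) / μ I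

/-- The dual weight `σ = w^(-1/(p-1))`. -/
def dualWeight (p : ℝ) (w : X → ℝ) (x : X) : ℝ :=
  w x ^ (-(1 / (p - 1)))

/-- The supremum over `I ∈ T` of `w(I) σ(I)^(p-1) / μ(I)^p`, with values in `[0, ∞]`. -/
def eApConst (μ : Measure X) (T : Set (Set X)) (p : ℝ) (w : X → ℝ) : ℝ≥0∞ :=
  ⨆ I ∈ T, (∫⁻ x in I, ENNReal.ofReal (w x) ∂μ) *
    (∫⁻ x in I, ENNReal.ofReal (dualWeight p w x) ∂μ) ^ (p - 1) / μ I ^ p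

/-- The constant `[w]_p` of an `A_p` weight, as a real number. -/
def apConst (μ : Measure X) (T : Set (Set X)) (p : ℝ) (w : X → ℝ) : ℝ :=
  (eApConst μ T p w).toReal

/-- `w` is an `A_p` weight with respect to `T`: an integrable, (almost everywhere) positive function
with `[w]_p < ∞`. -/
structure IsApWeight (μ : Measure X) (T : Set (Set X)) (p : ℝ) (w : X → ℝ) : Prop where
  integrable : Integrable w μ
  pos : ∀ᵐ x ∂μ, 0 < w x
  finite : eApConst μ T p w < ∞

/-- `H_p(z) = -(p-1) z^p + p z^(p-1)`. -/
def H (p z : ℝ) : ℝ :=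
  -(p - 1) * z ^ p + p * z ^ (p - 1)

/-- `ω_p : [0,1] → [1, p/(p-1)]`, the inverse function of `H_p` on `[1, p/(p-1)]`. -/
def omega (p : ℝ) : ℝ → ℝ :=
  Function.invFunOn (H p) (Icc 1 (p / (p - 1)))

/-- `φ ≥ 0` is an integrable function with `∫ φ^p w dμ = F` and `∫ φ dμ = f` (both finite). -/
structure IsAdmissible (μ : Measure X) (p : ℝ) (w : X → ℝ) (F f : ℝ) (φ : X → ℝ) : Prop where
  nonneg : ∀ᵐ x ∂μ, 0 ≤ φ x
  integrable : Integrable φ μ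
  integrable_pow : Integrable (fun x => φ x ^ p * w x) μ
  integral_pow_eq : ∫ x, φ x ^ p * w x ∂μ = F
  integral_eq : ∫ x, φ x ∂μ = f

/-- The integral `∫ (M_T φ)^p w dμ`, with values in `[0, ∞]`. -/
def maximalIntegral (μ : Measure X) (T : Set (Set X)) (p : ℝ) (w φ : X → ℝ) : ℝ≥0∞ :=
  ∫⁻ x, maximalFunction μ T φ x ^ p * ENNReal.ofReal (w x) ∂μ

/-- The Bellman function `B^T_{p,w}(F, f)`, the supremum of `∫ (M_T φ)^p w dμ` over all
`φ ≥ 0` with `∫ φ^p w dμ = F` and `∫ φ dμ = f`. -/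
def bellman (μ : Measure X) (T : Set (Set X)) (p : ℝ) (w : X → ℝ) (F f : ℝ) : ℝ≥0∞ :=
  ⨆ φ : X → ℝ, ⨆ _ : IsAdmissible μ p w F f φ, maximalIntegral μ T p w φ

/-- The quantity `f^p / (σ(X)^(p-1) F)`. -/
def firstArg (μ : Measure X) (p : ℝ) (w : X → ℝ) (F f : ℝ) : ℝ :=
  f ^ p / ((∫ x, dualWeight p w x ∂μ) ^ (p - 1) * F)

/-- The quantity `(∫ φ^(p-1) w dμ)^p' / (w(X)^(p'-1) F ω_p(f^p / (σ(X)^(p-1) F))^p)`, where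
`p' = p/(p-1)`. -/
def secondArg (μ : Measure X) (p : ℝ) (w : X → ℝ) (F f : ℝ) (φ : X → ℝ) : ℝ :=
  (∫ x, φ x ^ (p - 1) * w x ∂μ) ^ p.conjExponent /
    ((∫ x, w x ∂μ) ^ (p.conjExponent - 1) * (F * omega p (firstArg μ p w F f) ^ p))

end TreeMaximal

end

/-! The argument iterates a sharp unweighted-type inequality twice, with respect to the measures `σ
dμ` and `w dμ`.

For any finite nonzero measure `ν ≪ μ`, the tree maximal operator `M_ν` satisfies `t ν{M_ν g > t} ≤
∫_{M_ν g > t} g dν`, because a level set is built from almost disjoint tree sets with average above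
`t`. Integrating this against `t^(p-2)`, and using that the level set is all of `X` below the mean
`a` of `g`, gives `(p-1) ∫ (M_ν g)^p + a^p ν(X) ≤ p ∫ g (M_ν g)^(p-1)`. Hölder turns this into `y ≤
H_p(z)`, where `z^p` is the ratio of `∫ (M_ν g)^p` to `∫ g^p`; inverting `H_p` yields the factor
`ω_p(y)^p` (`IsTreeWith.lintegral_treeMaximal_rpow_le`).

The weight enters through the pointwise bound `(M_T φ)^(p-1) ≤ [w]_p M_w(h)` with `h =
M_σ(φ/σ)^(p-1) / w` (`IsTreeWith.maximalFunction_rpow_le`). Raising it to the power `p'` and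
applying the sharp inequality with exponent `p'` to `M_w`, then with exponent `p` to `M_σ`, gives
the two factors, since `∫ h^(p') w = ∫ M_σ(φ/σ)^p σ`. Finally `∫ h w ≥ ∫ φ^(p-1) w` by
differentiation, and `ω_(p')` is decreasing, so `h` can be eliminated from its argument. -/

namespace TreeMaximal

/-! ### The function `H_p` and its inverse `ω_p` -/

section Omega

variable {p : ℝ}

lemma continuousOn_H (p : ℝ) : ContinuousOn (H p) (Ici 1) := by
  have h : ∀ r : ℝ, ContinuousOn (fun z : ℝ => z ^ r) (Ici 1) := fun r =>
    continuousOn_id.rpow_const fun x hx => Or.inl (by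
      have : (1 : ℝ) ≤ x := hx
      simp only [id]
      linarith)
  exact (continuousOn_const.mul (h p)).add (continuousOn_const.mul (h (p - 1)))

/-- The derivative is `p (p-1) x^(p-2) (1 - x)`, negative for `x > 1`. -/
lemma strictAntiOn_H (hp : 1 < p) : StrictAntiOn (H p) (Ici 1) := by
  refine strictAntiOn_of_deriv_neg (convex_Ici 1) (continuousOn_H p) fun x hx => ?_
  rw [interior_Ici, mem_Ioi] at hx
  have hx0 : 0 < x := by linarith
  have h : HasDerivAt (H p)
      (-(p - 1) * (p * x ^ (p - 1)) + p * ((p - 1) * x ^ (p - 1 - 1))) x :=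
    ((Real.hasDerivAt_rpow_const (Or.inl hx0.ne')).const_mul _).add
      ((Real.hasDerivAt_rpow_const (Or.inl hx0.ne')).const_mul _)
  rw [h.deriv]
  have h1 : x ^ (p - 1) = x ^ (p - 1 - 1) * x := by
    rw [← Real.rpow_add_one hx0.ne']
    ring_nf
  have h2 : 0 < x ^ (p - 1 - 1) := Real.rpow_pos_of_pos hx0 _
  have h3 : 0 < p * (p - 1) * (x ^ (p - 1 - 1) * (x - 1)) :=
    mul_pos (mul_pos (by linarith) (by linarith)) (mul_pos h2 (by linarith))
  rw [h1]
  linarith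

lemma one_le_div_sub_one (hp : 1 < p) : 1 ≤ p / (p - 1) := by
  rw [le_div_iff₀ (by linarith)]
  linarith

lemma exists_H_eq (hp : 1 < p) {y : ℝ} (hy : y ∈ Icc (0 : ℝ) 1) :
    ∃ z ∈ Icc 1 (p / (p - 1)), H p z = y := by
  have h1 : H p 1 = 1 := by simp [H]
  have hp1 : 0 < p - 1 := by linarith
  have hz : 0 < p / (p - 1) := div_pos (by linarith) hp1
  have h0 : H p (p / (p - 1)) = 0 := by
    have : (p / (p - 1)) ^ p = (p / (p - 1)) ^ (p - 1) * (p / (p - 1)) := by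
      rw [← Real.rpow_add_one hz.ne']
      ring_nf
    rw [H, this]
    field_simp
    ring
  have := intermediate_value_Icc' (one_le_div_sub_one hp)
    ((continuousOn_H p).mono Icc_subset_Ici_self)
  rw [h0, h1] at this
  exact this hy

lemma omega_mem (hp : 1 < p) {y : ℝ} (hy : y ∈ Icc (0 : ℝ) 1) :
    omega p y ∈ Icc 1 (p / (p - 1)) :=
  Function.invFunOn_mem (exists_H_eq hp hy)

lemma H_omega (hp : 1 < p) {y : ℝ} (hy : y ∈ Icc (0 : ℝ) 1) : H p (omega p y) = y :=
  Function.invFunOn_eq (exists_H_eq hp hy)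

/-- Here `z` is not assumed to lie in `[1, p/(p-1)]`: below `1` the bound is trivial, and `H_p`
decreases on all of `[1, ∞)`. -/
lemma le_omega (hp : 1 < p) {y z : ℝ} (hy : y ∈ Icc (0 : ℝ) 1) (h : y ≤ H p z) :
    z ≤ omega p y := by
  have hm := omega_mem hp hy
  rcases le_total z 1 with hz | hz
  · exact hz.trans hm.1
  · rw [← H_omega hp hy] at h
    exact ((strictAntiOn_H hp).le_iff_ge hm.1 hz).1 h

lemma omega_anti (hp : 1 < p) {y z : ℝ} (hy : y ∈ Icc (0 : ℝ) 1) (hz : z ∈ Icc (0 : ℝ) 1)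
    (h : y ≤ z) : omega p z ≤ omega p y :=
  le_omega hp hy (by rwa [H_omega hp hz])

end Omega

/-! ### Stopping sets in the tree -/

section StoppingSet

variable {X : Type*} {C : Set X → Set (Set X)}

/-- The union of the sets satisfying `P` among the descendants of `I` of order at most `n`, arranged
so as to stop at the first such set. -/
def stoppingSet (C : Set X → Set (Set X)) (P : Set X → Prop) : ℕ → Set X → Set X
  | 0, I => {x | x ∈ I ∧ P I}
  | n + 1, I => {x | (x ∈ I ∧ P I) ∨ (¬ P I ∧ ∃ J ∈ C I, x ∈ stoppingSet C P n J)}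

lemma stoppingSet_of_pos {P : Set X → Prop} {I : Set X} (h : P I) (n : ℕ) :
    stoppingSet C P n I = I := by
  cases n <;> simp [stoppingSet, h]

lemma stoppingSet_succ_of_neg {P : Set X → Prop} {I : Set X} (h : ¬ P I) (n : ℕ) :
    stoppingSet C P (n + 1) I = ⋃ J ∈ C I, stoppingSet C P n J := by
  ext x
  simp [stoppingSet, h]

lemma stoppingSet_zero_of_neg {P : Set X → Prop} {I : Set X} (h : ¬ P I) :
    stoppingSet C P 0 I = ∅ := by
  ext x
  simp [stoppingSet, h]

lemma monotone_stoppingSet (C : Set X → Set (Set X)) (P : Set X → Prop) (I : Set X) :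
    Monotone fun n => stoppingSet C P n I := by
  refine monotone_nat_of_le_succ fun n => ?_
  induction n generalizing I with
  | zero => exact fun x hx => Or.inl hx
  | succ n ih =>
    rintro x (hx | ⟨h, J, hJ, hx⟩)
    · exact Or.inl hx
    · exact Or.inr ⟨h, J, hJ, ih J hx⟩

end StoppingSet

/-! ### Measurability and weak type inequality for tree maximal operators -/

section WeakType

variable {X : Type*} [MeasurableSpace X] {μ ν : Measure X} {T : Set (Set X)}
  {C : Set X → Set (Set X)} {g : X → ℝ≥0∞}

/-- The maximal operator of the family `T` with respect to the measure `ν`, acting on functions with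
values in `[0, ∞]`. -/
noncomputable def treeMaximal (ν : Measure X) (T : Set (Set X)) (g : X → ℝ≥0∞) (x : X) : ℝ≥0∞ :=
  ⨆ I ∈ T, ⨆ _ : x ∈ I, (∫⁻ y in I, g y ∂ν) / ν I

lemma le_treeMaximal {I : Set X} (hI : I ∈ T) {x : X} (hx : x ∈ I) :
    (∫⁻ y in I, g y ∂ν) / ν I ≤ treeMaximal ν T g x :=
  le_iSup₂_of_le I hI (le_iSup_of_le hx le_rfl)

lemma lt_treeMaximal_iff {t : ℝ≥0∞} {x : X} :
    t < treeMaximal ν T g x ↔ ∃ I ∈ T, x ∈ I ∧ t < (∫⁻ y in I, g y ∂ν) / ν I := by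
  simp only [treeMaximal, lt_iSup_iff, exists_prop]

lemma IsTreeWith.stoppingSet_subset (hT : IsTreeWith μ T C) (P : Set X → Prop) (n : ℕ) :
    ∀ I ∈ T, stoppingSet C P n I ⊆ I := by
  induction n with
  | zero => exact fun I _ x hx => hx.1
  | succ n ih =>
    rintro I hI x (hx | ⟨-, J, hJ, hx⟩)
    · exact hx.1
    · exact hT.children_le I hI J hJ (ih J (hT.children_subset I hI hJ) hx)

lemma IsTreeWith.measurableSet_stoppingSet (hT : IsTreeWith μ T C) (P : Set X → Prop) (n : ℕ) :
    ∀ I ∈ T, MeasurableSet (stoppingSet C P n I) := by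
  induction n with
  | zero =>
    intro I hI
    by_cases h : P I
    · rw [stoppingSet_of_pos h]
      exact hT.measurableSet I hI
    · rw [stoppingSet_zero_of_neg h]
      exact .empty
  | succ n ih =>
    intro I hI
    by_cases h : P I
    · rw [stoppingSet_of_pos h]
      exact hT.measurableSet I hI
    · rw [stoppingSet_succ_of_neg h]
      exact (hT.children_finite I hI).measurableSet_biUnion fun J hJ =>
        ih J (hT.children_subset I hI hJ)

/-- Where `P` fails the stopping set splits over the children, which are `μ`-almost disjoint, hence
`ν`-almost disjoint by absolute continuity. So the integral of `g` is additive, while subadditivity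
suffices for the measure. -/
lemma IsTreeWith.mul_measure_stoppingSet_le (hT : IsTreeWith μ T C) (hν : ν ≪ μ)
    (P : Set X → Prop) (t : ℝ≥0∞) (hP : ∀ I ∈ T, P I → t * ν I ≤ ∫⁻ x in I, g x ∂ν) (n : ℕ) :
    ∀ I ∈ T, t * ν (stoppingSet C P n I) ≤ ∫⁻ x in stoppingSet C P n I, g x ∂ν := by
  induction n with
  | zero =>
    intro I hI
    by_cases h : P I
    · rw [stoppingSet_of_pos h]
      exact hP I hI h
    · simp [stoppingSet_zero_of_neg h]
  | succ n ih =>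
    intro I hI
    by_cases h : P I
    · rw [stoppingSet_of_pos h]
      exact hP I hI h
    · rw [stoppingSet_succ_of_neg h]
      have hfin := hT.children_finite I hI
      have hsub := hT.children_subset I hI
      have hU : (⋃ J ∈ C I, stoppingSet C P n J) =
          ⋃ J ∈ hfin.toFinset, stoppingSet C P n J := by simp
      rw [hU, lintegral_biUnion_finset₀]
      · calc t * ν (⋃ J ∈ hfin.toFinset, stoppingSet C P n J)
            ≤ t * ∑ J ∈ hfin.toFinset, ν (stoppingSet C P n J) := by
              gcongr
              exact measure_biUnion_finset_le _ _
          _ = ∑ J ∈ hfin.toFinset, t * ν (stoppingSet C P n J) := Finset.mul_sum _ _ _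
          _ ≤ _ := Finset.sum_le_sum fun J hJ => ih J (hsub (by simpa using hJ))
      · intro J hJ K hK hJK
        have hJ : J ∈ C I := by simpa using hJ
        have hK : K ∈ C I := by simpa using hK
        have hd : AEDisjoint μ J K := hT.children_aedisjoint I hI hJ hK hJK
        have hd : AEDisjoint ν J K := hν hd
        exact hd.mono (hT.stoppingSet_subset P n J (hsub hJ)) (hT.stoppingSet_subset P n K (hsub hK))
      · intro J hJ
        exact (hT.measurableSet_stoppingSet P n J (hsub (by simpa using hJ))).nullMeasurableSet

lemma IsTreeWith.generation_subset (hT : IsTreeWith μ T C) (m : ℕ) : generation C m ⊆ T := by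
  rw [hT.eq_iUnion_generation]
  exact subset_iUnion _ m

/-- Climbing from `I` to `X` costs one step per generation. If an ancestor satisfies `P` itself, its
stopping set is the whole ancestor and no point is lost. -/
lemma IsTreeWith.mem_stoppingSet_univ (hT : IsTreeWith μ T C) (P : Set X → Prop) {x : X} (m : ℕ) :
    ∀ I ∈ generation C m, ∀ n, x ∈ stoppingSet C P n I → x ∈ stoppingSet C P (n + m) univ := by
  induction m with
  | zero =>
    intro I hI n hx
    rw [generation, mem_singleton_iff] at hI
    rwa [hI] at hx
  | succ m ih =>
    intro I hI n hx
    have hI' := hI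
    simp only [generation, mem_iUnion, exists_prop] at hI
    obtain ⟨K, hK, hIK⟩ := hI
    have hKT := hT.generation_subset m hK
    have : x ∈ stoppingSet C P (n + 1) K := by
      by_cases h : P K
      · rw [stoppingSet_of_pos h]
        exact hT.children_le K hKT I hIK
          (hT.stoppingSet_subset P n I (hT.children_subset K hKT hIK) hx)
      · rw [stoppingSet_succ_of_neg h]
        exact mem_biUnion hIK hx
    have := ih K hK (n + 1) this
    rwa [add_right_comm] at this

lemma IsTreeWith.exists_of_mem_stoppingSet (hT : IsTreeWith μ T C) (P : Set X → Prop) {x : X}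
    (n : ℕ) : ∀ I ∈ T, x ∈ stoppingSet C P n I → ∃ J ∈ T, x ∈ J ∧ P J := by
  induction n with
  | zero => exact fun I hI hx => ⟨I, hI, hx⟩
  | succ n ih =>
    rintro I hI (hx | ⟨-, J, hJ, hx⟩)
    · exact ⟨I, hI, hx⟩
    · exact ih J (hT.children_subset I hI hJ) hx

/-- This presents the level set as an increasing union of measurable sets to which the weak type
estimate applies; no measurability of `g` is needed. -/
lemma IsTreeWith.setOf_lt_treeMaximal (hT : IsTreeWith μ T C) (ν : Measure X) (g : X → ℝ≥0∞)
    (t : ℝ≥0∞) : {x | t < treeMaximal ν T g x} =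
      ⋃ n, stoppingSet C (fun I => t < (∫⁻ y in I, g y ∂ν) / ν I) n univ := by
  ext x
  rw [mem_ofPred_eq, lt_treeMaximal_iff, mem_iUnion]
  constructor
  · rintro ⟨I, hI, hx, h⟩
    rw [hT.eq_iUnion_generation, mem_iUnion] at hI
    obtain ⟨m, hm⟩ := hI
    exact ⟨0 + m, hT.mem_stoppingSet_univ _ m I hm 0 ⟨hx, h⟩⟩
  · rintro ⟨n, hn⟩
    exact hT.exists_of_mem_stoppingSet _ n univ hT.univ_mem hn

lemma IsTreeWith.measurable_treeMaximal (hT : IsTreeWith μ T C) (ν : Measure X)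
    (g : X → ℝ≥0∞) : Measurable (treeMaximal ν T g) := by
  refine measurable_of_Ioi fun t => ?_
  change MeasurableSet {x | t < treeMaximal ν T g x}
  rw [hT.setOf_lt_treeMaximal]
  exact .iUnion fun n => hT.measurableSet_stoppingSet _ n univ hT.univ_mem

lemma IsTreeWith.mul_measure_lt_treeMaximal_le (hT : IsTreeWith μ T C) (hν : ν ≪ μ) (t : ℝ≥0∞) :
    t * ν {x | t < treeMaximal ν T g x} ≤ ∫⁻ x in {x | t < treeMaximal ν T g x}, g x ∂ν := by
  rw [hT.setOf_lt_treeMaximal]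
  set P : Set X → Prop := fun I => t < (∫⁻ y in I, g y ∂ν) / ν I
  rw [(monotone_stoppingSet C P univ).measure_iUnion, ENNReal.mul_iSup]
  refine iSup_le fun n => (hT.mul_measure_stoppingSet_le hν P t ?_ n univ hT.univ_mem).trans
    (lintegral_mono_set (subset_iUnion (fun n => stoppingSet C P n univ) n))
  exact fun I _ h => (ENNReal.mul_lt_of_lt_div h).le

end WeakType

/-! ### The sharp strong type inequality -/

section SharpInequality

variable {X : Type*} [MeasurableSpace X] {ν : Measure X} {g : X → ℝ≥0∞} {p a : ℝ}

/-- On `(0, a]` the integrand is nonnegative with integral `a^p / (p (p-1))`. This is the surplus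
gained from the levels below the mean `a`. -/
lemma lintegral_Ioi_sub_rpow_ge (hp : 1 < p) (ha : 0 ≤ a) :
    ENNReal.ofReal (a ^ p) ≤ ENNReal.ofReal (p * (p - 1)) *
      ∫⁻ t in Ioi (0 : ℝ), ENNReal.ofReal (a * t ^ (p - 1 - 1) - t ^ (p - 1)) := by
  have hi : ∀ r : ℝ, -1 < r → IntegrableOn (fun t : ℝ => t ^ r) (Ioc 0 a) := fun r hr =>
    (intervalIntegrable_iff_integrableOn_Ioc_of_le ha).1 (intervalIntegral.intervalIntegrable_rpow' hr)
  have h1 := hi (p - 1 - 1) (by linarith)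
  have h2 := hi (p - 1) (by linarith)
  have hint : ∫ t in Ioc 0 a, (a * t ^ (p - 1 - 1) - t ^ (p - 1)) = a ^ p / (p * (p - 1)) := by
    rw [integral_sub (h1.const_mul a) h2, integral_const_mul, ← intervalIntegral.integral_of_le ha,
      ← intervalIntegral.integral_of_le ha, integral_rpow (Or.inl (by linarith)),
      integral_rpow (Or.inl (by linarith)), sub_add_cancel, sub_add_cancel,
      Real.zero_rpow (by linarith), Real.zero_rpow (by linarith)]
    have h3 : a ^ p = a * a ^ (p - 1) := by
      rw [← Real.rpow_one_add' ha (by linarith)]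
      ring_nf
    have : p - 1 ≠ 0 := by linarith
    have : p ≠ 0 := by linarith
    rw [h3]
    field_simp
    ring
  have hnn : 0 ≤ᵐ[volume.restrict (Ioc 0 a)] fun t => a * t ^ (p - 1 - 1) - t ^ (p - 1) := by
    refine (ae_restrict_mem measurableSet_Ioc).mono fun t ht => ?_
    have : t ^ (p - 1) = t * t ^ (p - 1 - 1) := by
      rw [← Real.rpow_one_add' ht.1.le (by linarith)]
      ring_nf
    simp only [Pi.zero_apply, this, ← sub_mul]
    exact mul_nonneg (by linarith [ht.2]) (Real.rpow_nonneg ht.1.le _)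
  have hpp : 0 < p * (p - 1) := mul_pos (by linarith) (by linarith)
  calc ENNReal.ofReal (a ^ p)
      = ENNReal.ofReal (p * (p - 1)) * ENNReal.ofReal (a ^ p / (p * (p - 1))) := by
        rw [← ENNReal.ofReal_mul hpp.le, mul_div_cancel₀ _ hpp.ne']
    _ = ENNReal.ofReal (p * (p - 1)) *
          ∫⁻ t in Ioc 0 a, ENNReal.ofReal (a * t ^ (p - 1 - 1) - t ^ (p - 1)) := by
        have := ofReal_integral_eq_lintegral_ofReal
          (f := fun t => a * t ^ (p - 1 - 1) - t ^ (p - 1)) ((h1.const_mul a).sub h2) hnn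
        rw [← hint, this]
    _ ≤ _ := by
        gcongr
        exact Ioc_subset_Ioi_self

/-- The weak type inequality for `K`, integrated against `t ^ (p - 2)`. -/
lemma lintegral_rpow_add_le (hp : 1 < p) (ha : 0 ≤ a) (hg : AEMeasurable g ν)
    (hga : ∫⁻ x, g x ∂ν = ENNReal.ofReal a * ν univ) {K : X → ℝ} (hK : Measurable K)
    (haK : ∀ x, a ≤ K x)
    (hweak : ∀ t, a ≤ t → ENNReal.ofReal t * ν {x | t < K x} ≤ ∫⁻ x in {x | t < K x}, g x ∂ν) :
    ENNReal.ofReal (p - 1) * ∫⁻ x, ENNReal.ofReal (K x ^ p) ∂ν + ENNReal.ofReal (a ^ p) * ν univ ≤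
      ENNReal.ofReal p * ∫⁻ x, g x * ENNReal.ofReal (K x ^ (p - 1)) ∂ν := by
  have hK0 : ∀ x, 0 ≤ K x := fun x => ha.trans (haK x)
  have hset : ∀ t, MeasurableSet {x | t < K x} := fun t => measurableSet_lt measurable_const hK
  -- Viewing the right side as an integral against `g dν` makes the layer cake formula apply to both
  -- sides, over the same level sets.
  have hγ : ∫⁻ x, g x * ENNReal.ofReal (K x ^ (p - 1)) ∂ν =
      ∫⁻ x, ENNReal.ofReal (K x ^ (p - 1)) ∂ν.withDensity g :=
    (lintegral_withDensity_eq_lintegral_mul₀ hg (hK.pow_const _).ennreal_ofReal.aemeasurable).symm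
  rw [hγ, lintegral_rpow_eq_lintegral_meas_lt_mul ν (.of_forall hK0) hK.aemeasurable (by linarith),
    lintegral_rpow_eq_lintegral_meas_lt_mul _ (.of_forall hK0) hK.aemeasurable (p := p - 1)
      (by linarith), ← mul_assoc, ← mul_assoc, ← ENNReal.ofReal_mul (by linarith),
    ← ENNReal.ofReal_mul (by linarith), mul_comm (p - 1) p]
  have hmeas : Measurable fun t : ℝ =>
      ENNReal.ofReal (a * t ^ (p - 1 - 1) - t ^ (p - 1)) * ν univ := by fun_prop
  have hmeas' : Measurable fun t : ℝ =>
      ENNReal.ofReal (a * t ^ (p - 1 - 1) - t ^ (p - 1)) := by fun_prop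
  calc _ ≤ ENNReal.ofReal (p * (p - 1)) *
          (∫⁻ t in Ioi (0 : ℝ), ν {x | t < K x} * ENNReal.ofReal (t ^ (p - 1))) +
        ENNReal.ofReal (p * (p - 1)) * (∫⁻ t in Ioi (0 : ℝ),
          ENNReal.ofReal (a * t ^ (p - 1 - 1) - t ^ (p - 1)) * ν univ) := by
        rw [lintegral_mul_const _ hmeas', ← mul_assoc]
        gcongr
        exact lintegral_Ioi_sub_rpow_ge hp ha
    _ = ENNReal.ofReal (p * (p - 1)) * ∫⁻ t in Ioi (0 : ℝ),
          (ν {x | t < K x} * ENNReal.ofReal (t ^ (p - 1)) +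
            ENNReal.ofReal (a * t ^ (p - 1 - 1) - t ^ (p - 1)) * ν univ) := by
        rw [lintegral_add_right _ hmeas, mul_add]
    _ ≤ _ := by
        gcongr ENNReal.ofReal (p * (p - 1)) * ?_
        refine setLIntegral_mono' measurableSet_Ioi fun t ht => ?_
        have ht : 0 < t := ht
        have hpow : t ^ (p - 1) = t * t ^ (p - 1 - 1) := by
          rw [← Real.rpow_one_add' ht.le (by linarith)]
          ring_nf
        have hpos : 0 ≤ t ^ (p - 1 - 1) := Real.rpow_nonneg ht.le _
        rw [withDensity_apply _ (hset t)]
        -- Below `a` the level set is everything and both sides equal `a t^(p-2) ν(X)`; from `a` on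
        -- the surplus term vanishes and the weak type bound is used.
        rcases lt_or_ge t a with hta | hta
        · have hu : {x | t < K x} = univ := eq_univ_of_forall fun x => hta.trans_le (haK x)
          rw [hu, Measure.restrict_univ, hga, mul_comm (ν univ), ← add_mul,
            ← ENNReal.ofReal_add (Real.rpow_nonneg ht.le _)
              (by rw [hpow, ← sub_mul]; exact mul_nonneg (by linarith) hpos),
            add_sub_cancel, ENNReal.ofReal_mul ha]
          exact (mul_right_comm _ _ _).le
        · have h0 : ENNReal.ofReal (a * t ^ (p - 1 - 1) - t ^ (p - 1)) = 0 := by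
            rw [ENNReal.ofReal_eq_zero, hpow, ← sub_mul]
            exact mul_nonpos_of_nonpos_of_nonneg (by linarith) hpos
          rw [h0, zero_mul, add_zero, hpow, ENNReal.ofReal_mul ht.le, ← mul_assoc,
            mul_comm (ν _)]
          gcongr
          exact hweak t hta

/-- With `A = z^p F`, dividing the hypothesis by `F` leaves `(p-1) z^p + y ≤ p z^(p-1)`, that is `y
≤ H_p(z)`. -/
lemma le_mul_omega_rpow (hp : 1 < p) {A F y : ℝ} (hA : 0 ≤ A) (hF : 0 < F)
    (hy : y ∈ Icc (0 : ℝ) 1)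
    (h : (p - 1) * A + F * y ≤ p * (F ^ (1 / p) * A ^ (1 / p.conjExponent))) :
    A ≤ F * omega p y ^ p := by
  have hp0 : 0 < p := by linarith
  have hp1 : p - 1 ≠ 0 := by linarith
  obtain ⟨u, hu⟩ : ∃ u, u = F ^ (1 / p) := ⟨_, rfl⟩
  obtain ⟨z, hz⟩ : ∃ z, z = A ^ (1 / p) / u := ⟨_, rfl⟩
  have hu0 : 0 < u := hu ▸ Real.rpow_pos_of_pos hF _
  have hz0 : 0 ≤ z := hz ▸ div_nonneg (Real.rpow_nonneg hA _) hu0.le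
  have hFu : F = u ^ p := by
    rw [hu, ← Real.rpow_mul hF.le, one_div_mul_cancel hp0.ne', Real.rpow_one]
  have hAz : A ^ (1 / p) = z * u := by rw [hz, div_mul_cancel₀ _ hu0.ne']
  have hA1 : A = z ^ p * u ^ p := by
    rw [← Real.mul_rpow hz0 hu0.le, ← hAz, ← Real.rpow_mul hA, one_div_mul_cancel hp0.ne',
      Real.rpow_one]
  have hA2 : A ^ (1 / p.conjExponent) = z ^ (p - 1) * u ^ (p - 1) := by
    rw [← Real.mul_rpow hz0 hu0.le, ← hAz, ← Real.rpow_mul hA, Real.conjExponent]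
    congr 1
    field_simp
  have hup : u * u ^ (p - 1) = u ^ p := by
    rw [← Real.rpow_one_add' hu0.le (by linarith)]
    ring_nf
  have hupos : 0 < u ^ p := Real.rpow_pos_of_pos hu0 _
  have hle : y ≤ H p z := by
    rw [← hu, hA2, hFu, hA1] at h
    have h' : u ^ p * y ≤ u ^ p * H p z := by
      have : u * (z ^ (p - 1) * u ^ (p - 1)) = u ^ p * z ^ (p - 1) := by
        rw [← hup]
        ring
      rw [this] at h
      rw [H]
      nlinarith
    exact le_of_mul_le_mul_left h' hupos
  have hzω := le_omega hp hy hle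
  rw [hA1, hFu, mul_comm]
  gcongr

/-- Hölder's inequality against the constant function `1`. -/
lemma lintegral_rpow_le_measure_univ_mul (hp : 1 < p) (hg : AEMeasurable g ν) :
    (∫⁻ x, g x ∂ν) ^ p ≤ ν univ ^ (p - 1) * ∫⁻ x, g x ^ p ∂ν := by
  have hp0 : 0 < p := by linarith
  have hp1 : p - 1 ≠ 0 := by linarith
  have h := ENNReal.lintegral_mul_le_Lp_mul_Lq ν (Real.HolderConjugate.conjExponent hp) hg
    (aemeasurable_const (b := (1 : ℝ≥0∞)))
  simp only [Pi.mul_apply, mul_one, ENNReal.one_rpow, lintegral_one] at h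
  have h' := ENNReal.rpow_le_rpow h hp0.le
  rw [ENNReal.mul_rpow_of_nonneg _ _ hp0.le, ← ENNReal.rpow_mul, ← ENNReal.rpow_mul,
    one_div_mul_cancel hp0.ne', ENNReal.rpow_one, mul_comm] at h'
  convert h' using 3
  rw [Real.conjExponent]
  field_simp

lemma rpow_div_mem_Icc [IsFiniteMeasure ν] (hp : 1 < p) (hg : AEMeasurable g ν)
    (hF : ∫⁻ x, g x ^ p ∂ν ≠ ∞) :
    (∫⁻ x, g x ∂ν).toReal ^ p / (ν.real univ ^ (p - 1) * (∫⁻ x, g x ^ p ∂ν).toReal) ∈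
      Icc (0 : ℝ) 1 := by
  refine ⟨by positivity, div_le_one_of_le₀ ?_ (by positivity)⟩
  have h := ENNReal.toReal_mono (ENNReal.mul_ne_top (ENNReal.rpow_ne_top_of_nonneg (by linarith)
    (measure_ne_top ν univ)) hF) (lintegral_rpow_le_measure_univ_mul hp hg)
  rwa [ENNReal.toReal_mul, ← ENNReal.toReal_rpow, ← ENNReal.toReal_rpow] at h

lemma lintegral_ne_top_of_rpow_ne_top [IsFiniteMeasure ν] (hp : 1 < p) (hg : AEMeasurable g ν)
    (hF : ∫⁻ x, g x ^ p ∂ν ≠ ∞) : ∫⁻ x, g x ∂ν ≠ ∞ := by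
  intro h
  have hhol := lintegral_rpow_le_measure_univ_mul hp hg
  rw [h, ENNReal.top_rpow_of_pos (by linarith), top_le_iff] at hhol
  exact ENNReal.mul_ne_top (ENNReal.rpow_ne_top_of_nonneg (by linarith)
    (measure_ne_top ν univ)) hF hhol

/-- A function which dominates the average of `g` and satisfies the weak type inequality of a
maximal function satisfies the sharp strong type inequality. -/
lemma lintegral_rpow_le_of_weak_type [IsFiniteMeasure ν] (hν : ν univ ≠ 0) (hp : 1 < p)
    (hg : AEMeasurable g ν) (hF : ∫⁻ x, g x ^ p ∂ν ≠ ∞) (hF0 : ∫⁻ x, g x ^ p ∂ν ≠ 0)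
    {M : X → ℝ≥0∞} (hM : Measurable M) (hgM : ∀ x, (∫⁻ x, g x ∂ν) / ν univ ≤ M x)
    (hweak : ∀ t, t * ν {x | t < M x} ≤ ∫⁻ x in {x | t < M x}, g x ∂ν) :
    ∫⁻ x, M x ^ p ∂ν ≤ ENNReal.ofReal ((∫⁻ x, g x ^ p ∂ν).toReal *
      omega p ((∫⁻ x, g x ∂ν).toReal ^ p /
        (ν.real univ ^ (p - 1) * (∫⁻ x, g x ^ p ∂ν).toReal)) ^ p) := by
  have hp0 : 0 < p := by linarith
  have hp1 : 0 < p - 1 := by linarith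
  have hVt : ν univ ≠ ∞ := measure_ne_top ν univ
  have hft := lintegral_ne_top_of_rpow_ne_top hp hg hF
  have hy := rpow_div_mem_Icc hp hg hF
  obtain ⟨F, hFdef⟩ : ∃ F, F = (∫⁻ x, g x ^ p ∂ν).toReal := ⟨_, rfl⟩
  obtain ⟨f, hfdef⟩ : ∃ f, f = (∫⁻ x, g x ∂ν).toReal := ⟨_, rfl⟩
  obtain ⟨V, hVdef⟩ : ∃ V, V = ν.real univ := ⟨_, rfl⟩
  have hF' : ∫⁻ x, g x ^ p ∂ν = ENNReal.ofReal F := by rw [hFdef, ENNReal.ofReal_toReal hF]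
  have hf' : ∫⁻ x, g x ∂ν = ENNReal.ofReal f := by rw [hfdef, ENNReal.ofReal_toReal hft]
  have hV' : ν univ = ENNReal.ofReal V := by rw [hVdef, Measure.real, ENNReal.ofReal_toReal hVt]
  have hFpos : 0 < F := hFdef ▸ ENNReal.toReal_pos hF0 hF
  have hVpos : 0 < V := hVdef ▸ ENNReal.toReal_pos hν hVt
  have hf0 : 0 ≤ f := hfdef ▸ ENNReal.toReal_nonneg
  rw [← hFdef, ← hfdef, ← hVdef] at hy ⊢
  obtain ⟨y, hydef⟩ : ∃ y, y = f ^ p / (V ^ (p - 1) * F) := ⟨_, rfl⟩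
  have hVp : 0 < V ^ (p - 1) := Real.rpow_pos_of_pos hVpos _
  rw [← hydef] at hy ⊢
  obtain ⟨a, hadef⟩ : ∃ a, a = f / V := ⟨_, rfl⟩
  have ha : 0 ≤ a := hadef ▸ div_nonneg hf0 hVpos.le
  have haM : ∀ x, ENNReal.ofReal a ≤ M x := by
    intro x
    rw [hadef, ENNReal.ofReal_div_of_pos hVpos, ← hf', ← hV']
    exact hgM x
  have hga : ∫⁻ x, g x ∂ν = ENNReal.ofReal a * ν univ := by
    rw [hf', hV', ← ENNReal.ofReal_mul ha, hadef, div_mul_cancel₀ _ hVpos.ne']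
  have hay : a ^ p * V = F * y := by
    have : V ^ p = V ^ (p - 1) * V := by
      rw [← Real.rpow_add_one hVpos.ne']
      ring_nf
    rw [hadef, hydef, Real.div_rpow hf0 hVpos.le, this]
    field_simp
  -- The bound for the truncations.
  have key : ∀ N : ℕ, a ≤ N →
      ∫⁻ x, min (M x) N ^ p ∂ν ≤ ENNReal.ofReal (F * omega p y ^ p) := by
    intro N hN
    have hmt : ∀ x, min (M x) (N : ℝ≥0∞) ≠ ∞ := fun x =>
      ne_top_of_le_ne_top (ENNReal.natCast_ne_top N) (min_le_right _ _)
    set K : X → ℝ := fun x => (min (M x) (N : ℝ≥0∞)).toReal with hK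
    have hKm : Measurable K := (hM.min measurable_const).ennreal_toReal
    have hKof : ∀ x, ENNReal.ofReal (K x) = min (M x) N := fun x => ENNReal.ofReal_toReal (hmt x)
    have hK0 : ∀ x, 0 ≤ K x := fun x => ENNReal.toReal_nonneg
    have haK : ∀ x, a ≤ K x := by
      intro x
      refine (ENNReal.ofReal_le_iff_le_toReal (hmt x)).1 (le_min (haM x) ?_)
      rw [← ENNReal.ofReal_natCast]
      exact ENNReal.ofReal_le_ofReal hN
    have hweakK : ∀ t, a ≤ t →
        ENNReal.ofReal t * ν {x | t < K x} ≤ ∫⁻ x in {x | t < K x}, g x ∂ν := by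
      intro t hta
      have hiff : ∀ x, t < K x ↔ ENNReal.ofReal t < M x ∧ ENNReal.ofReal t < (N : ℝ≥0∞) := by
        intro x
        rw [← lt_min_iff, ENNReal.ofReal_lt_iff_lt_toReal (ha.trans hta) (hmt x)]
      simp only [hiff]
      -- A level set of the truncation is either the one of `M` or empty.
      by_cases h : ENNReal.ofReal t < (N : ℝ≥0∞)
      · simpa only [h, and_true] using hweak (ENNReal.ofReal t)
      · simp [h]
    have hpow : ∀ x, ENNReal.ofReal (K x ^ p) = min (M x) N ^ p := fun x => by
      rw [← ENNReal.ofReal_rpow_of_nonneg (hK0 x) hp0.le, hKof]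
    have hpow' : ∀ x, ENNReal.ofReal (K x ^ (p - 1)) ^ p.conjExponent = min (M x) N ^ p :=
      fun x => by
        rw [← ENNReal.ofReal_rpow_of_nonneg (hK0 x) hp1.le, hKof, ← ENNReal.rpow_mul,
          Real.conjExponent, mul_div_cancel₀ _ hp1.ne']
    have h1 := lintegral_rpow_add_le hp ha hg hga hKm haK hweakK
    have h2 := ENNReal.lintegral_mul_le_Lp_mul_Lq ν (Real.HolderConjugate.conjExponent hp) hg
      (hKm.pow_const (p - 1)).ennreal_ofReal.aemeasurable
    simp only [Pi.mul_apply, hpow'] at h2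
    simp only [hpow] at h1
    -- This finiteness is the purpose of truncating: it allows passing to an inequality between real
    -- numbers.
    have hAt : ∫⁻ x, min (M x) N ^ p ∂ν ≠ ∞ := by
      refine ne_top_of_le_ne_top (b := (N : ℝ≥0∞) ^ p * ν univ) ?_ ?_
      · exact ENNReal.mul_ne_top
          (ENNReal.rpow_ne_top_of_nonneg hp0.le (ENNReal.natCast_ne_top N)) hVt
      · rw [← lintegral_const]
        exact lintegral_mono fun x => ENNReal.rpow_le_rpow (min_le_right _ _) hp0.le
    obtain ⟨A, hA⟩ : ∃ A, A = (∫⁻ x, min (M x) N ^ p ∂ν).toReal := ⟨_, rfl⟩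
    have hA0 : 0 ≤ A := hA ▸ ENNReal.toReal_nonneg
    have hA' : ∫⁻ x, min (M x) N ^ p ∂ν = ENNReal.ofReal A := by
      rw [hA, ENNReal.ofReal_toReal hAt]
    have hq : 0 ≤ 1 / p.conjExponent := one_div_nonneg.2 (div_nonneg hp0.le hp1.le)
    have h3 := h1.trans (mul_le_mul_right h2 (ENNReal.ofReal p))
    rw [hA', hF', hV', ENNReal.ofReal_rpow_of_nonneg hFpos.le (by positivity),
      ENNReal.ofReal_rpow_of_nonneg hA0 hq,
      ← ENNReal.ofReal_mul (p := F ^ (1 / p)) (by positivity),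
      ← ENNReal.ofReal_mul hp0.le, ← ENNReal.ofReal_mul hp1.le,
      ← ENNReal.ofReal_mul (by positivity), ← ENNReal.ofReal_add (by positivity) (by positivity),
      ENNReal.ofReal_le_ofReal_iff (by positivity), hay] at h3
    rw [hA']
    exact ENNReal.ofReal_le_ofReal (le_mul_omega_rpow hp hA0 hFpos hy h3)
  have hlim : Tendsto (fun N : ℕ => ∫⁻ x, min (M x) (N : ℝ≥0∞) ^ p ∂ν) atTop
      (𝓝 (∫⁻ x, M x ^ p ∂ν)) := by
    refine lintegral_tendsto_of_tendsto_of_monotone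
      (fun N => ((hM.min measurable_const).pow_const p).aemeasurable)
      (.of_forall fun x N N' h => ?_) (.of_forall fun x => ?_)
    · exact ENNReal.rpow_le_rpow (min_le_min le_rfl (by exact_mod_cast h)) hp0.le
    · have : Tendsto (fun N : ℕ => min (M x) (N : ℝ≥0∞)) atTop (𝓝 (min (M x) ⊤)) :=
        tendsto_const_nhds.min ENNReal.tendsto_nat_nhds_top
      rw [min_top_right] at this
      exact (ENNReal.continuous_rpow_const.tendsto _).comp this
  refine le_of_tendsto hlim ?_
  filter_upwards [eventually_ge_atTop ⌈a⌉₊] with N hN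
  exact key N ((Nat.le_ceil a).trans (by exact_mod_cast hN))

/-- The sharp `L^p` inequality for the maximal operator of a tree. -/
theorem IsTreeWith.lintegral_treeMaximal_rpow_le {μ : Measure X} {T : Set (Set X)}
    {C : Set X → Set (Set X)} (hT : IsTreeWith μ T C) [IsFiniteMeasure ν] (hνμ : ν ≪ μ)
    (hν : ν univ ≠ 0) (hp : 1 < p) (hg : AEMeasurable g ν) (hF : ∫⁻ x, g x ^ p ∂ν ≠ ∞) :
    ∫⁻ x, treeMaximal ν T g x ^ p ∂ν ≤ ENNReal.ofReal ((∫⁻ x, g x ^ p ∂ν).toReal *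
      omega p ((∫⁻ x, g x ∂ν).toReal ^ p /
        (ν.real univ ^ (p - 1) * (∫⁻ x, g x ^ p ∂ν).toReal)) ^ p) := by
  have hp0 : 0 < p := by linarith
  by_cases hF0 : ∫⁻ x, g x ^ p ∂ν = 0
  · have hg0 : g =ᵐ[ν] 0 := by
      rw [lintegral_eq_zero_iff' (hg.pow_const p)] at hF0
      filter_upwards [hF0] with x hx
      exact (ENNReal.rpow_eq_zero_iff_of_pos hp0).1 hx
    have hM0 : treeMaximal ν T g = 0 := by
      ext x
      have : ∀ I : Set X, ∫⁻ y in I, g y ∂ν = 0 := fun I => by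
        rw [lintegral_congr_ae (ae_restrict_of_ae hg0)]
        simp
      simp [treeMaximal, this]
    simp [hM0, ENNReal.zero_rpow_of_pos hp0]
  · refine lintegral_rpow_le_of_weak_type hν hp hg hF hF0 (hT.measurable_treeMaximal ν g) ?_
      fun t => hT.mul_measure_lt_treeMaximal_le hνμ t
    intro x
    simpa using le_treeMaximal (ν := ν) (g := g) hT.univ_mem (mem_univ x)

end SharpInequality

/-! ### The dual weight -/

section DualWeight

variable {X : Type*} {p : ℝ} {w : X → ℝ} {x : X}

lemma dualWeight_pos (hx : 0 < w x) : 0 < dualWeight p w x :=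
  Real.rpow_pos_of_pos hx _

lemma ofReal_dualWeight (hx : 0 < w x) :
    ENNReal.ofReal (dualWeight p w x) = ENNReal.ofReal (w x) ^ (-(1 / (p - 1))) := by
  rw [dualWeight, ENNReal.ofReal_rpow_of_pos hx]

end DualWeight

/-! ### Differentiation, `A_p` weights and domination by weighted maximal operators -/

section Weighted

variable {X : Type*} [MeasurableSpace X] {μ : Measure X} {T : Set (Set X)}
  {C : Set X → Set (Set X)} {p : ℝ} {w : X → ℝ}

lemma IsTreeWith.exists_mem_generation (hT : IsTreeWith μ T C) (x : X) (m : ℕ) :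
    ∃ I ∈ generation C m, x ∈ I := by
  induction m with
  | zero => exact ⟨univ, rfl, mem_univ x⟩
  | succ m ih =>
    obtain ⟨I, hI, hx⟩ := ih
    rw [hT.eq_sUnion_children I (hT.generation_subset m hI)] at hx
    obtain ⟨J, hJ, hx⟩ := hx
    exact ⟨J, mem_biUnion hI hJ, hx⟩

lemma IsTreeWith.exists_measureReal_lt (hT : IsTreeWith μ T C) (x : X) {δ : ℝ} (hδ : 0 < δ) :
    ∃ I ∈ T, x ∈ I ∧ μ.real I < δ := by
  obtain ⟨m, hm⟩ := (hT.tendsto_measure.eventually_lt_const (ENNReal.ofReal_pos.2 hδ)).exists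
  obtain ⟨I, hI, hx⟩ := hT.exists_mem_generation x m
  refine ⟨I, hT.generation_subset m hI, hx, ?_⟩
  have : μ I < ENNReal.ofReal δ := (le_iSup₂ (f := fun I _ => μ I) I hI).trans_lt hm
  exact ENNReal.toReal_lt_of_lt_ofReal this

/-- Ratios of integrals over the sets of the tree control the ratio of the densities. -/
lemma IsTreeWith.ae_enorm_le_mul [IsFiniteMeasure μ] (hT : IsTreeWith μ T C) {φ σ : X → ℝ}
    (hφ : Integrable φ μ) (hσ : Integrable σ μ) (hσ0 : ∀ᵐ x ∂μ, 0 < σ x) :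
    ∀ᵐ x ∂μ, ∀ m : ℝ≥0∞, (∀ I ∈ T, x ∈ I →
      ∫⁻ y in I, ‖φ y‖ₑ ∂μ ≤ m * ∫⁻ y in I, ENNReal.ofReal (σ y) ∂μ) →
        ‖φ x‖ₑ ≤ m * ENNReal.ofReal (σ x) := by
  -- The null set does not depend on `m`, so that `m` may later be taken to be a maximal function
  -- evaluated at `x`.
  filter_upwards [hT.differentiates _ hφ.norm, hT.differentiates _ hσ, hσ0] with x h1 h2 hx m hm
  rcases eq_or_ne m ∞ with rfl | hmt
  · rw [ENNReal.top_mul (ENNReal.ofReal_pos.2 hx).ne']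
    exact le_top
  obtain ⟨r, hr⟩ : ∃ r, r = m.toReal := ⟨_, rfl⟩
  have hr0 : 0 ≤ r := hr ▸ ENNReal.toReal_nonneg
  have hmr : m = ENNReal.ofReal r := by rw [hr, ENNReal.ofReal_toReal hmt]
  rw [hmr, ← ENNReal.ofReal_mul hr0, ← ofReal_norm]
  refine ENNReal.ofReal_le_ofReal (le_of_forall_pos_le_add fun ε hε => ?_)
  -- The error from `φ` counts once and the error from `σ` counts `r` times, hence the division by
  -- `r + 1`.
  obtain ⟨δ₁, hδ₁, H1⟩ := h1 (ε / (r + 1)) (by positivity)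
  obtain ⟨δ₂, hδ₂, H2⟩ := h2 (ε / (r + 1)) (by positivity)
  obtain ⟨I, hI, hxI, hμI⟩ := hT.exists_measureReal_lt x (lt_min hδ₁ hδ₂)
  have H1 := abs_lt.1 (H1 I hI hxI (hμI.trans_le (min_le_left _ _)))
  have H2 := abs_lt.1 (H2 I hI hxI (hμI.trans_le (min_le_right _ _)))
  have hle : ⨍ y in I, ‖φ y‖ ∂μ ≤ r * ⨍ y in I, σ y ∂μ := by
    have h := hm I hI hxI
    have e : ∫⁻ y in I, ‖φ y‖ₑ ∂μ = ENNReal.ofReal (∫ y in I, ‖φ y‖ ∂μ) := by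
      rw [ofReal_integral_norm_eq_lintegral_enorm hφ.integrableOn]
    have e' : ∫⁻ y in I, ENNReal.ofReal (σ y) ∂μ = ENNReal.ofReal (∫ y in I, σ y ∂μ) :=
      (ofReal_integral_eq_lintegral_ofReal hσ.integrableOn
        (ae_restrict_of_ae (hσ0.mono fun _ h => h.le))).symm
    have hnn : 0 ≤ ∫ y in I, σ y ∂μ :=
      integral_nonneg_of_ae (ae_restrict_of_ae (hσ0.mono fun _ h => h.le))
    rw [e, e', hmr, ← ENNReal.ofReal_mul hr0,
      ENNReal.ofReal_le_ofReal_iff (mul_nonneg hr0 hnn)] at h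
    rw [setAverage_eq, setAverage_eq, smul_eq_mul, smul_eq_mul, mul_left_comm]
    exact mul_le_mul_of_nonneg_left h (inv_nonneg.2 measureReal_nonneg)
  have hε' : ε = r * (ε / (r + 1)) + ε / (r + 1) := by
    field_simp
  have h3 : r * ⨍ y in I, σ y ∂μ ≤ r * (σ x + ε / (r + 1)) :=
    mul_le_mul_of_nonneg_left (by linarith [H2.2]) hr0
  linarith [H1.1]

namespace IsApWeight

lemma aemeasurable_dualWeight (hw : IsApWeight μ T p w) : AEMeasurable (dualWeight p w) μ :=
  hw.integrable.aemeasurable.pow_const _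

lemma ae_ofReal_ne_zero (hw : IsApWeight μ T p w) : ∀ᵐ x ∂μ, ENNReal.ofReal (w x) ≠ 0 :=
  hw.pos.mono fun _ hx => (ENNReal.ofReal_pos.2 hx).ne'

lemma ae_ofReal_dualWeight_ne_zero (hw : IsApWeight μ T p w) :
    ∀ᵐ x ∂μ, ENNReal.ofReal (dualWeight p w x) ≠ 0 :=
  hw.pos.mono fun _ hx => (ENNReal.ofReal_pos.2 (dualWeight_pos hx)).ne'

lemma absolutelyContinuous (hw : IsApWeight μ T p w) :
    μ ≪ μ.withDensity fun x => ENNReal.ofReal (w x) :=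
  withDensity_absolutelyContinuous' hw.integrable.aemeasurable.ennreal_ofReal hw.ae_ofReal_ne_zero

lemma absolutelyContinuous_dualWeight (hw : IsApWeight μ T p w) :
    μ ≪ μ.withDensity fun x => ENNReal.ofReal (dualWeight p w x) :=
  withDensity_absolutelyContinuous' hw.aemeasurable_dualWeight.ennreal_ofReal
    hw.ae_ofReal_dualWeight_ne_zero

lemma mul_rpow_div_le (I : Set X) (hI : I ∈ T) (hIm : MeasurableSet I) :
    μ.withDensity (fun x => ENNReal.ofReal (w x)) I *
      μ.withDensity (fun x => ENNReal.ofReal (dualWeight p w x)) I ^ (p - 1) / μ I ^ p ≤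
      eApConst μ T p w := by
  rw [withDensity_apply _ hIm, withDensity_apply _ hIm]
  exact le_iSup₂ (f := fun I (_ : I ∈ T) => (∫⁻ x in I, ENNReal.ofReal (w x) ∂μ) *
    (∫⁻ x in I, ENNReal.ofReal (dualWeight p w x) ∂μ) ^ (p - 1) / μ I ^ p) I hI

/-- The `A_p` condition on `I = X`, together with `w(X) > 0`, forces `σ(X) < ∞`. -/
lemma integrable_dualWeight [IsProbabilityMeasure μ] (hT : IsTreeWith μ T C) (hp : 1 < p)
    (hw : IsApWeight μ T p w) : Integrable (dualWeight p w) μ := by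
  have hnn : 0 ≤ᵐ[μ] dualWeight p w := hw.pos.mono fun _ hx => (dualWeight_pos hx).le
  refine ⟨hw.aemeasurable_dualWeight.aestronglyMeasurable, ?_⟩
  rw [hasFiniteIntegral_iff_ofReal hnn, ← setLIntegral_univ, ← withDensity_apply _ .univ]
  have h := (mul_rpow_div_le (p := p) (w := w) (μ := μ) univ hT.univ_mem .univ).trans_lt hw.finite
  rw [measure_univ (μ := μ), ENNReal.one_rpow, div_one] at h
  by_contra hs
  rw [not_lt, top_le_iff] at hs
  rw [hs, ENNReal.top_rpow_of_pos (by linarith), ENNReal.mul_top] at h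
  · exact lt_irrefl _ h
  · intro h0
    simpa using hw.absolutelyContinuous h0

end IsApWeight

/-- The function `φ / σ`. -/
noncomputable def divDual (p : ℝ) (w φ : X → ℝ) (x : X) : ℝ≥0∞ :=
  ‖φ x‖ₑ / ENNReal.ofReal (dualWeight p w x)

/-- The function `M_σ(φ / σ) ^ (p - 1) / w`, where `M_σ` is the maximal operator with respect to the
measure `σ dμ`. -/
noncomputable def iteratedMaximal (μ : Measure X) (T : Set (Set X)) (p : ℝ) (w φ : X → ℝ) (x : X) :
    ℝ≥0∞ :=
  treeMaximal (μ.withDensity fun x => ENNReal.ofReal (dualWeight p w x)) T (divDual p w φ) x ^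
    (p - 1) / ENNReal.ofReal (w x)

lemma setLIntegral_withDensity_div {W h : X → ℝ≥0∞} (hW : AEMeasurable W μ)
    (hW0 : ∀ᵐ x ∂μ, W x ≠ 0) (hWt : ∀ᵐ x ∂μ, W x < ∞) {I : Set X} (hI : MeasurableSet I) :
    ∫⁻ x in I, h x / W x ∂μ.withDensity W = ∫⁻ x in I, h x ∂μ := by
  rw [setLIntegral_withDensity_eq_setLIntegral_mul_non_measurable₀ μ hW.restrict _ hI
    (ae_restrict_of_ae hWt)]
  refine lintegral_congr_ae (ae_restrict_of_ae ?_)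
  filter_upwards [hW0, hWt] with x h0 ht
  exact ENNReal.mul_div_cancel h0 ht.ne

lemma mul_div_rpow_eq {a b : ℝ≥0∞} {r s : ℝ} (hb0 : b ≠ 0) (hbt : b ≠ ∞) (hr : 0 ≤ r)
    (hs : s = 1 - r) : b * (a / b) ^ r = a ^ r * b ^ s := by
  rw [ENNReal.div_rpow_of_nonneg _ _ hr, div_eq_mul_inv, mul_left_comm, hs,
    ENNReal.rpow_sub _ _ hb0 hbt, ENNReal.rpow_one, div_eq_mul_inv]

variable {φ : X → ℝ}

lemma setLIntegral_divDual (hw : IsApWeight μ T p w) {I : Set X} (hI : MeasurableSet I) :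
    ∫⁻ x in I, divDual p w φ x ∂μ.withDensity (fun x => ENNReal.ofReal (dualWeight p w x)) =
      ∫⁻ x in I, ‖φ x‖ₑ ∂μ :=
  setLIntegral_withDensity_div hw.aemeasurable_dualWeight.ennreal_ofReal
    hw.ae_ofReal_dualWeight_ne_zero (.of_forall fun _ => ENNReal.ofReal_lt_top) hI

lemma setLIntegral_iteratedMaximal (hw : IsApWeight μ T p w) {I : Set X} (hI : MeasurableSet I) :
    ∫⁻ x in I, iteratedMaximal μ T p w φ x ∂μ.withDensity (fun x => ENNReal.ofReal (w x)) =
      ∫⁻ x in I, treeMaximal (μ.withDensity fun x => ENNReal.ofReal (dualWeight p w x)) T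
        (divDual p w φ) x ^ (p - 1) ∂μ :=
  setLIntegral_withDensity_div hw.integrable.aemeasurable.ennreal_ofReal
    hw.ae_ofReal_ne_zero (.of_forall fun _ => ENNReal.ofReal_lt_top) hI

/-- Almost everywhere `σ · σ^(-p) = σ^(1-p) = w`. -/
lemma lintegral_divDual_rpow (hp : 1 < p) (hw : IsApWeight μ T p w) :
    ∫⁻ x, divDual p w φ x ^ p ∂μ.withDensity (fun x => ENNReal.ofReal (dualWeight p w x)) =
      ∫⁻ x, ‖φ x‖ₑ ^ p * ENNReal.ofReal (w x) ∂μ := by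
  rw [lintegral_withDensity_eq_lintegral_mul_non_measurable₀ μ
    hw.aemeasurable_dualWeight.ennreal_ofReal (.of_forall fun _ => ENNReal.ofReal_lt_top)]
  refine lintegral_congr_ae ?_
  filter_upwards [hw.pos, hw.ae_ofReal_dualWeight_ne_zero] with x hx h0
  have hp1 : p - 1 ≠ 0 := by linarith
  rw [Pi.mul_apply, divDual, mul_div_rpow_eq h0 ENNReal.ofReal_ne_top (by linarith) rfl,
    ofReal_dualWeight hx, ← ENNReal.rpow_mul]
  have : -(1 / (p - 1)) * (1 - p) = 1 := by
    field_simp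
    ring
  rw [this, ENNReal.rpow_one]

/-- The exponents match because `(p-1) p' = p` and `w^(1-p') = σ`. -/
lemma lintegral_iteratedMaximal_rpow (hp : 1 < p) (hw : IsApWeight μ T p w) :
    ∫⁻ x, iteratedMaximal μ T p w φ x ^ p.conjExponent
        ∂μ.withDensity (fun x => ENNReal.ofReal (w x)) =
      ∫⁻ x, treeMaximal (μ.withDensity fun x => ENNReal.ofReal (dualWeight p w x)) T
        (divDual p w φ) x ^ p ∂μ.withDensity (fun x => ENNReal.ofReal (dualWeight p w x)) := by
  rw [lintegral_withDensity_eq_lintegral_mul_non_measurable₀ μ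
      hw.aemeasurable_dualWeight.ennreal_ofReal (.of_forall fun _ => ENNReal.ofReal_lt_top),
    lintegral_withDensity_eq_lintegral_mul_non_measurable₀ μ
      hw.integrable.aemeasurable.ennreal_ofReal (.of_forall fun _ => ENNReal.ofReal_lt_top)]
  refine lintegral_congr_ae ?_
  filter_upwards [hw.pos, hw.ae_ofReal_ne_zero] with x hx h0
  have hp1 : 0 < p - 1 := by linarith
  have hs : -(1 / (p - 1)) = 1 - p.conjExponent := by
    rw [Real.conjExponent]
    field_simp
    ring
  rw [Pi.mul_apply, Pi.mul_apply, iteratedMaximal,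
    mul_div_rpow_eq (r := p.conjExponent) h0 ENNReal.ofReal_ne_top
      (div_nonneg (by linarith) hp1.le) hs,
    ofReal_dualWeight hx, ← ENNReal.rpow_mul, Real.conjExponent, mul_div_cancel₀ _ hp1.ne',
    mul_comm]

/-- Used with `e = ∫_I |φ|`, `m = μ(I)`, `s = σ(I)`, `u = w(I)`: it factors the `A_p` quotient out
of a power of the average. -/
lemma div_rpow_eq_mul {e m s u : ℝ≥0∞} (hm0 : m ≠ 0) (hmt : m ≠ ∞) (hs0 : s ≠ 0) (hst : s ≠ ∞)
    (hu0 : u ≠ 0) (hut : u ≠ ∞) (hp : 1 < p) :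
    (e / m) ^ (p - 1) = u * s ^ (p - 1) / m ^ p * ((e / s) ^ (p - 1) * m / u) := by
  have hp1 : 0 ≤ p - 1 := by linarith
  have h1 : u * u⁻¹ = 1 := ENNReal.mul_inv_cancel hu0 hut
  have h2 : s ^ (p - 1) * (s ^ (p - 1))⁻¹ = 1 :=
    ENNReal.mul_inv_cancel (by simp [ENNReal.rpow_eq_zero_iff, hs0, hst])
      (ENNReal.rpow_ne_top_of_nonneg hp1 hst)
  have h3 : (m ^ (p - 1))⁻¹ = m * (m ^ p)⁻¹ := by
    rw [ENNReal.rpow_sub _ _ hm0 hmt, ENNReal.rpow_one, ENNReal.inv_div (Or.inl hmt) (Or.inl hm0),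
      div_eq_mul_inv]
  rw [ENNReal.div_rpow_of_nonneg _ _ hp1, ENNReal.div_rpow_of_nonneg _ _ hp1]
  simp only [div_eq_mul_inv, h3]
  calc e ^ (p - 1) * (m * (m ^ p)⁻¹)
      = (u * u⁻¹) * (s ^ (p - 1) * (s ^ (p - 1))⁻¹) * (e ^ (p - 1) * (m * (m ^ p)⁻¹)) := by
        rw [h1, h2, one_mul, one_mul]
    _ = _ := by ring

/-- The pointwise domination of the maximal operator by an iteration of weighted ones. -/
lemma IsTreeWith.maximalFunction_rpow_le [IsProbabilityMeasure μ] (hT : IsTreeWith μ T C)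
    (hp : 1 < p) (hw : IsApWeight μ T p w) (φ : X → ℝ) (x : X) :
    maximalFunction μ T φ x ^ (p - 1) ≤ eApConst μ T p w *
      treeMaximal (μ.withDensity fun x => ENNReal.ofReal (w x)) T (iteratedMaximal μ T p w φ) x := by
  have hp1 : 0 < p - 1 := by linarith
  have : IsFiniteMeasure (μ.withDensity fun x => ENNReal.ofReal (w x)) :=
    isFiniteMeasure_withDensity_ofReal hw.integrable.2
  have : IsFiniteMeasure (μ.withDensity fun x => ENNReal.ofReal (dualWeight p w x)) :=
    isFiniteMeasure_withDensity_ofReal (hw.integrable_dualWeight hT hp).2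
  suffices h : maximalFunction μ T φ x ≤ (eApConst μ T p w *
      treeMaximal (μ.withDensity fun x => ENNReal.ofReal (w x)) T (iteratedMaximal μ T p w φ) x) ^
        (1 / (p - 1)) by
    refine (ENNReal.rpow_le_rpow h hp1.le).trans_eq ?_
    rw [← ENNReal.rpow_mul, one_div_mul_cancel hp1.ne', ENNReal.rpow_one]
  refine iSup₂_le fun I hI => iSup_le fun hx => ?_
  rw [← ENNReal.rpow_le_rpow_iff hp1, ← ENNReal.rpow_mul, one_div_mul_cancel hp1.ne',
    ENNReal.rpow_one]
  have hIm := hT.measurableSet I hI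
  have hm0 := (hT.measure_pos I hI).ne'
  rw [div_rpow_eq_mul hm0 (measure_ne_top μ I)
    (fun h => hm0 (hw.absolutelyContinuous_dualWeight h)) (measure_ne_top _ I)
    (fun h => hm0 (hw.absolutelyContinuous h)) (measure_ne_top _ I) hp]
  -- The remaining factor is at most a `w`-average of `h = M_σ(φ/σ)^(p-1) / w`: the `σ`-average `e /
  -- s` of `φ/σ` is at most `M_σ(φ/σ)` at every point of `I`, so `(e/s)^(p-1) μ(I) ≤ ∫_I h w dμ`.
  refine mul_le_mul' (IsApWeight.mul_rpow_div_le I hI hIm) (le_trans ?_ (le_treeMaximal hI hx))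
  rw [setLIntegral_iteratedMaximal hw hIm]
  gcongr
  rw [← setLIntegral_const]
  refine setLIntegral_mono' hIm fun y hy => ENNReal.rpow_le_rpow ?_ hp1.le
  rw [← setLIntegral_divDual hw hIm]
  exact le_treeMaximal hI hy

/-- Differentiation gives `|φ| ≤ σ M_σ(φ/σ)` almost everywhere, and `σ^(p-1) w = 1`. -/
lemma IsTreeWith.lintegral_rpow_mul_le [IsProbabilityMeasure μ] (hT : IsTreeWith μ T C)
    (hp : 1 < p) (hw : IsApWeight μ T p w) (hφ : Integrable φ μ) :
    ∫⁻ x, ‖φ x‖ₑ ^ (p - 1) * ENNReal.ofReal (w x) ∂μ ≤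
      ∫⁻ x, iteratedMaximal μ T p w φ x ∂μ.withDensity (fun x => ENNReal.ofReal (w x)) := by
  have hp1 : 0 < p - 1 := by linarith
  have hσ := hw.integrable_dualWeight hT hp
  have : IsFiniteMeasure (μ.withDensity fun x => ENNReal.ofReal (dualWeight p w x)) :=
    isFiniteMeasure_withDensity_ofReal hσ.2
  have hI := setLIntegral_iteratedMaximal (φ := φ) hw .univ
  rw [setLIntegral_univ, setLIntegral_univ] at hI
  rw [hI]
  refine lintegral_mono_ae ?_
  filter_upwards [hT.ae_enorm_le_mul hφ hσ (hw.pos.mono fun _ hx => dualWeight_pos hx), hw.pos,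
    hw.ae_ofReal_ne_zero] with x h hx h0
  have h := h (treeMaximal (μ.withDensity fun x => ENNReal.ofReal (dualWeight p w x)) T
    (divDual p w φ) x) fun I hI hxI => by
      have hIm := hT.measurableSet I hI
      have hm0 := (hT.measure_pos I hI).ne'
      rw [← setLIntegral_divDual hw hIm,
        ← withDensity_apply (fun y => ENNReal.ofReal (dualWeight p w y)) hIm,
        ← ENNReal.div_le_iff (fun h => hm0 (hw.absolutelyContinuous_dualWeight h))
          (measure_ne_top _ I)]
      exact le_treeMaximal hI hxI
  calc ‖φ x‖ₑ ^ (p - 1) * ENNReal.ofReal (w x)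
      ≤ (treeMaximal (μ.withDensity fun x => ENNReal.ofReal (dualWeight p w x)) T
          (divDual p w φ) x * ENNReal.ofReal (dualWeight p w x)) ^ (p - 1) *
            ENNReal.ofReal (w x) := by gcongr
    _ = _ := by
      have : -(1 / (p - 1)) * (p - 1) = -1 := by
        field_simp
      rw [ENNReal.mul_rpow_of_nonneg _ _ hp1.le, ofReal_dualWeight hx, ← ENNReal.rpow_mul, this,
        ENNReal.rpow_neg_one, mul_assoc, ENNReal.inv_mul_cancel h0 ENNReal.ofReal_ne_top, mul_one]

lemma IsTreeWith.maximalIntegral_le [IsProbabilityMeasure μ] (hT : IsTreeWith μ T C)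
    (hp : 1 < p) (hw : IsApWeight μ T p w) (φ : X → ℝ) :
    maximalIntegral μ T p w φ ≤ eApConst μ T p w ^ p.conjExponent *
      ∫⁻ x, treeMaximal (μ.withDensity fun x => ENNReal.ofReal (w x)) T
        (iteratedMaximal μ T p w φ) x ^ p.conjExponent
          ∂μ.withDensity (fun x => ENNReal.ofReal (w x)) := by
  have hp1 : 0 < p - 1 := by linarith
  have hq : 0 ≤ p.conjExponent := div_nonneg (by linarith) hp1.le
  rw [lintegral_withDensity_eq_lintegral_mul_non_measurable₀ μ
    hw.integrable.aemeasurable.ennreal_ofReal (.of_forall fun _ => ENNReal.ofReal_lt_top),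
    ← lintegral_const_mul' _ _ (ENNReal.rpow_ne_top_of_nonneg hq hw.finite.ne)]
  refine lintegral_mono fun x => ?_
  have h := ENNReal.rpow_le_rpow (hT.maximalFunction_rpow_le hp hw φ x) hq
  rw [← ENNReal.rpow_mul, ENNReal.mul_rpow_of_nonneg _ _ hq] at h
  have hpq : (p - 1) * p.conjExponent = p := by
    rw [Real.conjExponent, mul_div_cancel₀ _ hp1.ne']
  rw [hpq] at h
  rw [Pi.mul_apply, mul_left_comm, mul_comm]
  gcongr

end Weighted

/-! ### The bound for a single function -/

section MainBound

variable {X : Type*} [MeasurableSpace X] {μ : Measure X} {T : Set (Set X)}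
  {C : Set X → Set (Set X)} {p F f : ℝ} {w φ : X → ℝ}

lemma withDensity_ofReal_real_univ {h : X → ℝ} (hi : Integrable h μ) (h0 : 0 ≤ᵐ[μ] h) :
    (μ.withDensity fun x => ENNReal.ofReal (h x)).real univ = ∫ x, h x ∂μ := by
  rw [integral_eq_lintegral_of_nonneg_ae h0 hi.1, Measure.real, withDensity_apply _ .univ,
    setLIntegral_univ]

/-- The hypothesis `y ≤ c * g` covers a vanishing denominator: then `x` and `y` vanish too and both
quotients are `0`. -/
lemma div_mul_le_div_mul {x y c g b : ℝ} (hx : 0 ≤ x) (hxy : x ≤ y) (hy : y ≤ c * g)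
    (hc : 0 ≤ c) (hgb : g ≤ b) : x / (c * b) ≤ y / (c * g) := by
  rcases (hx.trans (hxy.trans hy)).eq_or_lt with h | h
  · have hx0 : x = 0 := by linarith
    have hy0 : y = 0 := by linarith
    simp [hx0, hy0]
  · exact div_le_div₀ (hx.trans hxy) hxy h (mul_le_mul_of_nonneg_left hgb hc)

lemma one_lt_conjExponent (hp : 1 < p) : 1 < p.conjExponent :=
  (Real.HolderConjugate.conjExponent hp).symm.lt

lemma conjExponent_div_sub_one (hp : 1 < p) : p.conjExponent / (p.conjExponent - 1) = p := by
  have : p - 1 ≠ 0 := by linarith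
  rw [Real.conjExponent]
  field_simp
  ring

namespace IsAdmissible

lemma lintegral_enorm_rpow_mul (hφ : IsAdmissible μ p w F f φ) (hw : ∀ᵐ x ∂μ, 0 < w x) (r : ℝ)
    (hr : 0 ≤ r) : ∫⁻ x, ‖φ x‖ₑ ^ r * ENNReal.ofReal (w x) ∂μ =
      ∫⁻ x, ENNReal.ofReal (φ x ^ r * w x) ∂μ := by
  refine lintegral_congr_ae ?_
  filter_upwards [hφ.nonneg, hw] with x h0 hx
  rw [Real.enorm_eq_ofReal h0, ENNReal.ofReal_rpow_of_nonneg h0 hr,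
    ENNReal.ofReal_mul (Real.rpow_nonneg h0 _)]

lemma ae_rpow_mul_nonneg (hφ : IsAdmissible μ p w F f φ) (hw : ∀ᵐ x ∂μ, 0 < w x) (r : ℝ) :
    0 ≤ᵐ[μ] fun x => φ x ^ r * w x := by
  filter_upwards [hφ.nonneg, hw] with x h0 hx
  exact mul_nonneg (Real.rpow_nonneg h0 _) hx.le

lemma nonneg_left (hφ : IsAdmissible μ p w F f φ) (hw : ∀ᵐ x ∂μ, 0 < w x) : 0 ≤ F := by
  rw [← hφ.integral_pow_eq]
  exact integral_nonneg_of_ae (hφ.ae_rpow_mul_nonneg hw p)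

lemma lintegral_divDual_rpow (hφ : IsAdmissible μ p w F f φ) (hp : 1 < p)
    (hw : IsApWeight μ T p w) :
    ∫⁻ x, divDual p w φ x ^ p ∂μ.withDensity (fun x => ENNReal.ofReal (dualWeight p w x)) =
      ENNReal.ofReal F := by
  rw [TreeMaximal.lintegral_divDual_rpow hp hw, hφ.lintegral_enorm_rpow_mul hw.pos p (by linarith),
    ← ofReal_integral_eq_lintegral_ofReal hφ.integrable_pow (hφ.ae_rpow_mul_nonneg hw.pos p),
    hφ.integral_pow_eq]

lemma toReal_lintegral_divDual (hφ : IsAdmissible μ p w F f φ) (hw : IsApWeight μ T p w) :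
    (∫⁻ x, divDual p w φ x ∂μ.withDensity
      (fun x => ENNReal.ofReal (dualWeight p w x))).toReal = f := by
  have h := setLIntegral_divDual (φ := φ) hw .univ
  rw [setLIntegral_univ, setLIntegral_univ] at h
  rw [h, ← integral_norm_eq_lintegral_enorm hφ.integrable.1, ← hφ.integral_eq]
  exact integral_congr_ae (hφ.nonneg.mono fun x hx => Real.norm_of_nonneg hx)

/-- The bound for the maximal integral of a single function. -/
theorem main_bound [IsProbabilityMeasure μ] (hφ : IsAdmissible μ p w F f φ)
    (hT : IsTreeWith μ T C) (hp : 1 < p) (hw : IsApWeight μ T p w) :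
    Integrable (fun x => φ x ^ (p - 1) * w x) μ ∧
      firstArg μ p w F f ∈ Icc (0 : ℝ) 1 ∧
      secondArg μ p w F f φ ∈ Icc (0 : ℝ) 1 ∧
      maximalIntegral μ T p w φ ≤
        ENNReal.ofReal (apConst μ T p w ^ (p / (p - 1)) *
          (F * omega p (firstArg μ p w F f) ^ p) *
          omega p.conjExponent (secondArg μ p w F f φ) ^ p.conjExponent) := by
  have hp1 : 0 < p - 1 := by linarith
  obtain ⟨q, hq⟩ : ∃ q, q = p.conjExponent := ⟨_, rfl⟩
  have hq1 : 1 < q := hq ▸ one_lt_conjExponent hp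
  have hσ := hw.integrable_dualWeight hT hp
  have hσ0 : 0 ≤ᵐ[μ] dualWeight p w := hw.pos.mono fun _ hx => (dualWeight_pos hx).le
  have hw0 : 0 ≤ᵐ[μ] w := hw.pos.mono fun _ hx => hx.le
  obtain ⟨νs, hνs⟩ : ∃ ν, ν = μ.withDensity fun x => ENNReal.ofReal (dualWeight p w x) := ⟨_, rfl⟩
  obtain ⟨νw, hνw⟩ : ∃ ν, ν = μ.withDensity fun x => ENNReal.ofReal (w x) := ⟨_, rfl⟩
  have hfs : IsFiniteMeasure νs := hνs ▸ isFiniteMeasure_withDensity_ofReal hσ.2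
  have hfw : IsFiniteMeasure νw := hνw ▸ isFiniteMeasure_withDensity_ofReal hw.integrable.2
  have hacs : νs ≪ μ := hνs ▸ withDensity_absolutelyContinuous _ _
  have hacw : νw ≪ μ := hνw ▸ withDensity_absolutelyContinuous _ _
  have hs0 : νs univ ≠ 0 := fun h => by
    have : μ univ = 0 := hw.absolutelyContinuous_dualWeight (hνs ▸ h)
    simp at this
  have hw0' : νw univ ≠ 0 := fun h => by
    have : μ univ = 0 := hw.absolutelyContinuous (hνw ▸ h)
    simp at this
  have hσX : νs.real univ = ∫ x, dualWeight p w x ∂μ :=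
    hνs ▸ withDensity_ofReal_real_univ hσ hσ0
  have hwX : νw.real univ = ∫ x, w x ∂μ := hνw ▸ withDensity_ofReal_real_univ hw.integrable hw0
  have hF0 := hφ.nonneg_left hw.pos
  have hgm : AEMeasurable (divDual p w φ) νs :=
    (hφ.integrable.aemeasurable.enorm.div hw.aemeasurable_dualWeight.ennreal_ofReal).mono_ac hacs
  have hgF : ∫⁻ x, divDual p w φ x ^ p ∂νs = ENNReal.ofReal F :=
    hνs ▸ hφ.lintegral_divDual_rpow hp hw
  have hgf : (∫⁻ x, divDual p w φ x ∂νs).toReal = f := hνs ▸ hφ.toReal_lintegral_divDual hw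
  have hgFt : ∫⁻ x, divDual p w φ x ^ p ∂νs ≠ ∞ := hgF ▸ ENNReal.ofReal_ne_top
  have hfirst := rpow_div_mem_Icc hp hgm hgFt
  have hB := hT.lintegral_treeMaximal_rpow_le hacs hs0 hp hgm hgFt
  rw [hgf, hgF, ENNReal.toReal_ofReal hF0, hσX, ← firstArg] at hfirst hB
  obtain ⟨B, hBdef⟩ : ∃ B, B = F * omega p (firstArg μ p w F f) ^ p := ⟨_, rfl⟩
  have hB0 : 0 ≤ B := hBdef ▸ mul_nonneg hF0
    (Real.rpow_nonneg (zero_le_one.trans (omega_mem hp hfirst).1) _)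
  rw [← hBdef] at hB
  have hkm : AEMeasurable (iteratedMaximal μ T p w φ) νw :=
    (((hT.measurable_treeMaximal _ _).pow_const _).aemeasurable.div
      hw.integrable.aemeasurable.ennreal_ofReal).mono_ac hacw
  have hkG : ∫⁻ x, iteratedMaximal μ T p w φ x ^ q ∂νw =
      ∫⁻ x, treeMaximal νs T (divDual p w φ) x ^ p ∂νs := by
    rw [hνw, hνs, hq]
    exact lintegral_iteratedMaximal_rpow hp hw
  -- `G` is the common value of `∫ h^q w` and `∫ M_σ(φ/σ)^p σ`; the sharp inequality for `M_σ`
  -- bounds it by `B`.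
  obtain ⟨G, hG⟩ : ∃ G, G = (∫⁻ x, iteratedMaximal μ T p w φ x ^ q ∂νw).toReal := ⟨_, rfl⟩
  have hkt : ∫⁻ x, iteratedMaximal μ T p w φ x ^ q ∂νw ≠ ∞ :=
    hkG ▸ ne_top_of_le_ne_top ENNReal.ofReal_ne_top hB
  have hGB : G ≤ B := by
    rw [hG, hkG]
    exact ENNReal.toReal_le_of_le_ofReal hB0 hB
  have hG0 : 0 ≤ G := hG ▸ ENNReal.toReal_nonneg
  have hkt' := lintegral_ne_top_of_rpow_ne_top hq1 hkm hkt
  obtain ⟨k, hk⟩ : ∃ k, k = (∫⁻ x, iteratedMaximal μ T p w φ x ∂νw).toReal := ⟨_, rfl⟩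
  have hlow := hT.lintegral_rpow_mul_le hp hw hφ.integrable
  rw [← hνw, hφ.lintegral_enorm_rpow_mul hw.pos _ hp1.le] at hlow
  have hnn := hφ.ae_rpow_mul_nonneg hw.pos (p - 1)
  have hint : Integrable (fun x => φ x ^ (p - 1) * w x) μ := by
    refine ⟨((hφ.integrable.aemeasurable.pow_const _).mul
      hw.integrable.aemeasurable).aestronglyMeasurable, ?_⟩
    rw [hasFiniteIntegral_iff_ofReal hnn]
    exact hlow.trans_lt hkt'.lt_top
  have hsk : ∫ x, φ x ^ (p - 1) * w x ∂μ ≤ k := by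
    rw [integral_eq_lintegral_of_nonneg_ae hnn hint.1, hk]
    exact ENNReal.toReal_mono hkt' hlow
  have hs : 0 ≤ ∫ x, φ x ^ (p - 1) * w x ∂μ := integral_nonneg_of_ae hnn
  have hkG' : k ^ q ≤ νw.real univ ^ (q - 1) * G := by
    have h := ENNReal.toReal_mono (ENNReal.mul_ne_top (ENNReal.rpow_ne_top_of_nonneg (by linarith)
      (measure_ne_top νw univ)) hkt) (lintegral_rpow_le_measure_univ_mul hq1 hkm)
    rwa [ENNReal.toReal_mul, ← ENNReal.toReal_rpow, ← ENNReal.toReal_rpow, ← hk, ← hG] at h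
  have harg := rpow_div_mem_Icc hq1 hkm hkt
  rw [← hk, ← hG] at harg
  -- Replacing `∫ φ^(p-1) w` by the larger `k` and `B` by the smaller `G` increases the quotient,
  -- which stays at most `1` by Hölder.
  have hle : secondArg μ p w F f φ ≤ k ^ q / (νw.real univ ^ (q - 1) * G) := by
    rw [secondArg, ← hq, ← hBdef, ← hwX]
    exact div_mul_le_div_mul (Real.rpow_nonneg hs _) (Real.rpow_le_rpow hs hsk (by linarith)) hkG'
      (by positivity) hGB
  have hsecond : secondArg μ p w F f φ ∈ Icc (0 : ℝ) 1 := by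
    refine ⟨?_, hle.trans harg.2⟩
    rw [secondArg, ← hBdef, ← hwX]
    positivity
  refine ⟨hint, hfirst, hsecond, ?_⟩
  have hM := hT.lintegral_treeMaximal_rpow_le hacw hw0' hq1 hkm hkt
  rw [← hk, ← hG] at hM
  -- Both replacements go the right way: `G ≤ B` in the factor in front, and `ω_q` is decreasing in
  -- its argument.
  have hω := omega_anti hq1 hsecond harg hle
  have hω0 := zero_le_one.trans (omega_mem hq1 harg).1
  have hmain := hT.maximalIntegral_le hp hw φ
  rw [← hνw, ← hq] at hmain
  have hc : eApConst μ T p w ^ q = ENNReal.ofReal (apConst μ T p w ^ q) := by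
    rw [apConst, ENNReal.toReal_rpow,
      ENNReal.ofReal_toReal (ENNReal.rpow_ne_top_of_nonneg (by linarith) hw.finite.ne)]
  have hc0 : 0 ≤ apConst μ T p w := ENNReal.toReal_nonneg
  have hpq : p / (p - 1) = q := hq.symm
  rw [hpq, ← hq, ← hBdef, mul_assoc]
  refine hmain.trans ?_
  rw [hc, ENNReal.ofReal_mul (Real.rpow_nonneg hc0 _)]
  gcongr
  refine hM.trans (ENNReal.ofReal_le_ofReal ?_)
  gcongr

end IsAdmissible

end MainBound

end TreeMaximal

/-- Here `p' = p.conjExponent = p / (p - 1)`. -/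
theorem theorem3 {X : Type*} [MeasurableSpace X] (μ : Measure X) [IsProbabilityMeasure μ]
    (T : Set (Set X)) (hT : TreeMaximal.IsTree μ T) (p : ℝ) (hp : 1 < p)
    (w : X → ℝ) (hw : TreeMaximal.IsApWeight μ T p w) :
    Integrable (TreeMaximal.dualWeight p w) μ ∧
    (∀ (F f : ℝ) (φ : X → ℝ), TreeMaximal.IsAdmissible μ p w F f φ →
      Integrable (fun x => φ x ^ (p - 1) * w x) μ ∧
      TreeMaximal.firstArg μ p w F f ∈ Icc (0 : ℝ) 1 ∧
      TreeMaximal.secondArg μ p w F f φ ∈ Icc (0 : ℝ) 1 ∧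
      TreeMaximal.maximalIntegral μ T p w φ ≤
        ENNReal.ofReal (TreeMaximal.apConst μ T p w ^ (p / (p - 1)) *
          (F * TreeMaximal.omega p (TreeMaximal.firstArg μ p w F f) ^ p) *
          TreeMaximal.omega p.conjExponent
            (TreeMaximal.secondArg μ p w F f φ) ^ p.conjExponent)) ∧
    (∀ F f : ℝ,
      TreeMaximal.bellman μ T p w F f ≤
        ENNReal.ofReal (p ^ p.conjExponent * TreeMaximal.apConst μ T p w ^ (p / (p - 1)) *
          (F * TreeMaximal.omega p (TreeMaximal.firstArg μ p w F f) ^ p))) := by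
  obtain ⟨C, hT⟩ := hT
  refine ⟨hw.integrable_dualWeight hT hp, fun F f φ hφ => hφ.main_bound hT hp hw,
    fun F f => iSup₂_le fun φ hφ => ?_⟩
  obtain ⟨-, h1, h2, h⟩ := hφ.main_bound hT hp hw
  refine h.trans (ENNReal.ofReal_le_ofReal ?_)
  have hq := TreeMaximal.one_lt_conjExponent hp
  -- The values of `ω_(p')` are at most `p'/(p'-1) = p`, which gives the constant `p^(p')`.
  have hω := TreeMaximal.omega_mem hq h2
  rw [TreeMaximal.conjExponent_div_sub_one hp] at hω
  have hc : 0 ≤ TreeMaximal.apConst μ T p w := ENNReal.toReal_nonneg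
  have hF := hφ.nonneg_left hw.pos
  have hω1 := zero_le_one.trans (TreeMaximal.omega_mem hp h1).1
  have hpow := Real.rpow_le_rpow (zero_le_one.trans hω.1) hω.2 (zero_le_one.trans hq.le)
  rw [mul_assoc (p ^ _), mul_comm (p ^ _)]
  exact mul_le_mul_of_nonneg_left hpow (by positivity)
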